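/- **Theorem.** Let $X$ be a real Banach space and let $(a_n)_{n \in \mathbb N}$ be a sequence of positive real numbers. Suppose that $(a_n)$ is $(w^*, X^*)$-acceptable, that is, there is a sequence $(x_n^*)_{n \in \mathbb N}$ of continuous linear functionals on $X$ with $\|x_n^*\| = a_n$ for every $n$ such that the zero functional is a cluster point of the sequence $(x_n^*)$ in the weak* topology $\sigma(X^*, X)$ (every weak* neighbourhood of $0$ contains $x_n^*$ for infinitely many $n$). Then $$\sum_{n} a_n^{-1} = \infty .$$ -/

import Mathlib

open Filter Topology

/-- A sequence `a` of (positive) reals is `(w*, X*)`-acceptable: there are functionals `f n` in the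
dual `X*` with `‖f n‖ = a n` such that `0` is a cluster point of the sequence `f` in the weak*
topology `σ(X*, X)`, i.e. every weak* neighbourhood of `0` contains `f n` for infinitely many
indices `n`. -/
def IsWeakStarAcceptable (X : Type*) [NormedAddCommGroup X] [NormedSpace ℝ X] (a : ℕ → ℝ) : Prop :=
  ∃ f : ℕ → StrongDual ℝ X, (∀ n, ‖f n‖ = a n) ∧
    MapClusterPt (0 : WeakDual ℝ X) atTop (fun n => StrongDual.toWeakDual (f n))

/-! If `∑ ‖φ n‖⁻¹` converged, some `x` would satisfy `c ≤ |φ n x|` for all `n`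
(`exists_forall_le_abs_apply`), so a weak* neighbourhood of `0` would miss every `φ n`. Such an `x`
comes from Ball's plank argument on finite matrices. A row scaling `d` gives `diagonal d * A` a
positive polar part `P` with diagonal `s i ^ 2`. Bang's sign choice applied to `P` bounds every
coordinate below, while a trace inequality gives `∑ d i ^ 2 ≤ 1`. A bounded map from `ℓ²` and weak
compactness of its unit ball pass to infinitely many functionals. -/

section Plank

/-! ### Matrix form of the plank theorem -/

open Matrix

variable {ι : Type*} [Fintype ι] [DecidableEq ι]

/-- **Bang's lemma**, homogeneous case. -/
theorem Matrix.IsSymm.exists_signs_diag_mul_le {P : Matrix ι ι ℝ} (hP : P.IsSymm) {u : ι → ℝ}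
    (hu : ∀ i, 0 < u i) :
    ∃ x : ι → ℝ, (∀ i, |x i| = u i) ∧ ∀ i, P i i * u i ≤ |(P *ᵥ x) i| := by
  obtain ⟨x, hx, hmax⟩ := (Fintype.piFinset fun i => ({u i, -u i} : Finset ℝ)).exists_max_image
    (fun x => x ⬝ᵥ P *ᵥ x) ⟨u, by simp⟩
  simp only [Fintype.mem_piFinset, Finset.mem_insert, Finset.mem_singleton] at hx hmax
  have habs (i : ι) : |x i| = u i := by
    rcases hx i with h | h <;> simp [h, abs_of_pos (hu i)]
  refine ⟨x, habs, fun i => ?_⟩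
  -- Flipping one sign cannot increase the quadratic form at its maximiser.
  have hflip := hmax (x - Pi.single i (2 * x i)) fun j => by
    rcases eq_or_ne j i with rfl | hj
    · rcases hx j with h | h <;> simp [h] <;> ring_nf <;> simp
    · simpa [hj] using hx j
  have hsymm : x ⬝ᵥ P *ᵥ Pi.single i (2 * x i) = Pi.single i (2 * x i) ⬝ᵥ P *ᵥ x := by
    rw [dotProduct_mulVec, ← mulVec_transpose, hP.eq, dotProduct_comm]
  have hdiag : Pi.single i (2 * x i) ⬝ᵥ P *ᵥ Pi.single i (2 * x i) = 4 * x i ^ 2 * P i i := by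
    simp [Matrix.mulVec_single]
    ring
  rw [mulVec_sub, dotProduct_sub, sub_dotProduct, sub_dotProduct, hsymm, hdiag,
    single_dotProduct] at hflip
  have h1 : P i i * u i ^ 2 ≤ x i * (P *ᵥ x) i := by
    rw [← habs i, sq_abs]; linarith
  have h2 : x i * (P *ᵥ x) i ≤ u i * |(P *ᵥ x) i| := by
    rw [← habs i, ← abs_mul]; exact le_abs_self _
  have := hu i
  nlinarith

/-- Expand `0 ≤ tr ((E - Vᵀ) P (Eᵀ - V))`, using that `V` is orthogonal. -/
theorem Matrix.PosSemidef.two_mul_trace_mul_mul_le {P : Matrix ι ι ℝ} (hP : P.PosSemidef)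
    (E : Matrix ι ι ℝ) {V : Matrix ι ι ℝ} (hV : V * Vᵀ = 1) :
    2 * (E * P * V).trace ≤ (E * P * Eᵀ).trace + P.trace := by
  have hsymm : Pᵀ = P := by simpa using hP.isHermitian.eq
  have h := (hP.conjTranspose_mul_mul_same (Eᵀ - V)).trace_nonneg
  have h1 : (Vᵀ * P * Eᵀ).trace = (E * P * V).trace := by
    rw [← trace_transpose]; simp [transpose_mul, hsymm, Matrix.mul_assoc]
  have h2 : (Vᵀ * P * V).trace = P.trace := by
    rw [Matrix.mul_assoc, trace_mul_comm, Matrix.mul_assoc, hV, Matrix.mul_one]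
  simp only [conjTranspose_eq_transpose_of_trivial, transpose_sub, transpose_transpose,
    Matrix.sub_mul, Matrix.mul_sub, trace_sub, h1, h2] at h
  linarith

/-- Polar decomposition of an invertible matrix, with a given positive part. -/
theorem Matrix.exists_polar {G P : Matrix ι ι ℝ} (hG : IsUnit G) (hP : P.IsSymm)
    (h : P * P = G * Gᵀ) : ∃ V : Matrix ι ι ℝ, V * Vᵀ = 1 ∧ G = P * V := by
  have hPu : IsUnit P.det := by
    have hGd := (isUnit_iff_isUnit_det _).1 hG
    have := congrArg det h
    rw [det_mul, det_mul, det_transpose] at this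
    exact isUnit_of_mul_isUnit_left (this ▸ hGd.mul hGd)
  refine ⟨P⁻¹ * G, ?_, by rw [mul_nonsing_inv_cancel_left _ _ hPu]⟩
  rw [transpose_mul, transpose_nonsing_inv, hP.eq]
  calc P⁻¹ * G * (Gᵀ * P⁻¹) = P⁻¹ * (G * Gᵀ) * P⁻¹ := by simp only [Matrix.mul_assoc]
    _ = 1 := by rw [← h, nonsing_inv_mul_cancel_left _ _ hPu, mul_nonsing_inv _ hPu]

open scoped MatrixOrder in
theorem Matrix.sqrt_mul_transpose_spec (G : Matrix ι ι ℝ) :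
    (CFC.sqrt (G * Gᵀ)).PosSemidef ∧ CFC.sqrt (G * Gᵀ) * CFC.sqrt (G * Gᵀ) = G * Gᵀ := by
  have h : 0 ≤ G * Gᵀ := by
    rw [nonneg_iff_posSemidef]
    simpa using posSemidef_self_mul_conjTranspose G
  exact ⟨nonneg_iff_posSemidef.1 (CFC.sqrt_nonneg _), CFC.sqrt_mul_sqrt_self _ h⟩

open scoped MatrixOrder Matrix.Norms.L2Operator in
theorem Matrix.continuous_sqrt_mul_transpose :
    Continuous fun G : Matrix ι ι ℝ => CFC.sqrt (G * Gᵀ) := by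
  refine CFC.continuousOn_sqrt.comp_continuous (by fun_prop) fun G => ?_
  change 0 ≤ G * Gᵀ
  rw [nonneg_iff_posSemidef]
  simpa using posSemidef_self_mul_conjTranspose G

theorem Matrix.isUnit_diagonal_exp (τ : ι → ℝ) :
    IsUnit (diagonal fun i => Real.exp (τ i)) := by
  rw [isUnit_diagonal, Pi.isUnit_iff]
  exact fun i => (Real.exp_pos _).ne'.isUnit

theorem two_mul_mul_sub_le_exp {s : ℝ} (hs : 0 < s) (t : ℝ) :
    2 * s * t - 2 * s ^ 2 ≤ Real.exp t := by
  rcases le_total 0 t with h | h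
  · nlinarith [Real.quadratic_le_exp_of_nonneg h, sq_nonneg (t - 2 * s)]
  · nlinarith [Real.exp_pos t, mul_nonneg hs.le (neg_nonneg.2 h), sq_nonneg s]

/-- Supplies the coercivity of the functional minimised in `Matrix.exists_scaling_polar_diag`. -/
theorem sq_mul_abs_sub_le {s : ℝ} (hs : 0 < s) (t : ℝ) :
    s ^ 2 * |t| - 2 * s ^ 3 ≤ s * Real.exp t - s ^ 2 * t := by
  have h1 := mul_le_mul_of_nonneg_left (two_mul_mul_sub_le_exp hs t) hs.le
  have h2 := mul_pos hs (Real.exp_pos t)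
  have h3 : 0 < s ^ 3 := by positivity
  rcases abs_cases t with ⟨h, _⟩ | ⟨h, _⟩ <;> rw [h] <;> nlinarith

theorem eq_of_forall_mul_le_exp {p q : ℝ}
    (h : ∀ t, q * t ≤ (Real.exp t ^ 2 - 1) * p / 2) : p = q := by
  let g : ℝ → ℝ := fun t => (Real.exp t ^ 2 - 1) * p / 2 - q * t
  have hmin : IsLocalMin g 0 := Eventually.of_forall fun t => by
    simpa [g] using h t
  have hd : HasDerivAt g _ 0 :=
    (((((Real.hasDerivAt_exp 0).pow 2).sub_const 1).mul_const p).div_const 2).sub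
      ((hasDerivAt_id (0 : ℝ)).const_mul q)
  have := hmin.hasDerivAt_eq_zero hd
  norm_num at this
  linarith

open scoped MatrixOrder in
/-- An invertible matrix has a row scaling whose positive polar part has a prescribed diagonal. -/
theorem Matrix.exists_scaling_polar_diag {A : Matrix ι ι ℝ} (hA : IsUnit A) {s : ι → ℝ}
    (hs : ∀ i, 0 < s i) (hAs : ∀ i, s i ≤ A i i) :
    ∃ (d : ι → ℝ) (P V : Matrix ι ι ℝ), (∀ i, 0 < d i) ∧ P.PosSemidef ∧ V * Vᵀ = 1 ∧
      diagonal d * A = P * V ∧ ∀ i, P i i = s i ^ 2 := by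
  let G : (ι → ℝ) → Matrix ι ι ℝ := fun τ => diagonal (fun i => Real.exp (τ i)) * A
  let Q : (ι → ℝ) → Matrix ι ι ℝ := fun τ => CFC.sqrt (G τ * (G τ)ᵀ)
  have hQ (τ) : (Q τ).PosSemidef := (sqrt_mul_transpose_spec (G τ)).1
  have hQQ (τ) : Q τ * Q τ = G τ * (G τ)ᵀ := (sqrt_mul_transpose_spec (G τ)).2
  have hQs (τ) : (Q τ).IsSymm := by simpa using (hQ τ).isHermitian
  have hGu (τ) : IsUnit (G τ) := (isUnit_diagonal_exp τ).mul hA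
  -- The critical point equation of this functional is `Q τ i i = s i ^ 2`.
  let f : (ι → ℝ) → ℝ := fun τ => (Q τ).trace - ∑ i, s i ^ 2 * τ i
  have hQc : Continuous Q := continuous_sqrt_mul_transpose.comp
    ((Continuous.matrix_diagonal (continuous_pi fun i =>
      Real.continuous_exp.comp (continuous_apply i))).matrix_mul continuous_const)
  have hf : Continuous f := (hQc.matrix_trace).sub (by fun_prop)
  have hlow (τ) : ∑ i, (s i ^ 2 * |τ i| - 2 * s i ^ 3) ≤ f τ := by
    obtain ⟨V, hV, hGV⟩ := exists_polar (hGu τ) (hQs τ) (hQQ τ)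
    have h := (hQ τ).two_mul_trace_mul_mul_le 1 hV
    simp only [Matrix.one_mul, transpose_one, Matrix.mul_one, ← hGV] at h
    have h' : ∑ i, s i * Real.exp (τ i) ≤ (G τ).trace := by
      refine Finset.sum_le_sum fun i _ => ?_
      simp only [G, diag_apply, diagonal_mul]
      nlinarith [hAs i, Real.exp_pos (τ i)]
    calc _ ≤ ∑ i, (s i * Real.exp (τ i) - s i ^ 2 * τ i) :=
          Finset.sum_le_sum fun i _ => sq_mul_abs_sub_le (hs i) _
      _ ≤ f τ := by rw [Finset.sum_sub_distrib]; simp only [f]; linarith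
  obtain ⟨τ, hτ⟩ : ∃ τ, ∀ σ, f τ ≤ f σ := by
    refine hf.exists_forall_le' 0 ?_
    let R := f 0 + ∑ i, 2 * s i ^ 3
    refine mem_cocompact.2 ⟨Set.univ.pi fun i => Set.Icc (-(R / s i ^ 2)) (R / s i ^ 2),
      isCompact_univ_pi fun i => isCompact_Icc, fun σ hσ => ?_⟩
    by_contra hlt
    rw [Set.mem_ofPred_eq, not_le] at hlt
    refine hσ fun i _ => abs_le.1 ?_
    have h1 := hlow σ
    rw [Finset.sum_sub_distrib] at h1
    have h2 := Finset.single_le_sum (f := fun i => s i ^ 2 * |σ i|)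
      (fun i _ => by positivity) (Finset.mem_univ i)
    rw [le_div_iff₀ (pow_pos (hs i) 2), mul_comm]
    simp only [R]
    linarith
  obtain ⟨V, hV, hGV⟩ := exists_polar (hGu τ) (hQs τ) (hQQ τ)
  refine ⟨_, Q τ, V, fun i => Real.exp_pos (τ i), hQ τ, hV, hGV, fun i => ?_⟩
  refine eq_of_forall_mul_le_exp fun t => ?_
  let e : ι → ℝ := fun j => Real.exp ((Pi.single i t : ι → ℝ) j)
  have hG' : G (τ + Pi.single i t) = diagonal e * G τ := by
    simp only [G, e, ← Matrix.mul_assoc, diagonal_mul_diagonal, Pi.add_apply, Real.exp_add]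
    congr 2; ext; rw [mul_comm]
  -- The perturbed `G` and `diagonal e * Q τ` have the same positive polar part. The trace
  -- inequality then bounds its trace from above, so the square root need not be differentiated.
  obtain ⟨W, hW, hGW⟩ := exists_polar (G := diagonal e * Q τ) (P := Q (τ + Pi.single i t))
    (by
      refine (isUnit_diagonal_exp _).mul (isUnit_of_mul_isUnit_left (y := Q τ) ?_)
      rw [hQQ]
      exact (hGu τ).mul ((isUnit_transpose _).2 (hGu τ)))
    (hQs _) (by
      rw [hQQ, hG', transpose_mul (diagonal e) (G τ), transpose_mul (diagonal e) (Q τ), (hQs τ).eq]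
      calc _ = diagonal e * (G τ * (G τ)ᵀ) * (diagonal e)ᵀ := by simp only [Matrix.mul_assoc]
        _ = _ := by rw [← hQQ]; simp only [Matrix.mul_assoc])
  have hW' : Wᵀ * Wᵀᵀ = 1 := by
    rw [transpose_transpose]; exact mul_eq_one_comm.1 hW
  have h := (hQ τ).two_mul_trace_mul_mul_le (diagonal e) hW'
  rw [hGW, Matrix.mul_assoc, hW, Matrix.mul_one, ← hGW, diagonal_transpose] at h
  have h1 : (diagonal e * Q τ * diagonal e).trace
      = (Q τ).trace + (Real.exp t ^ 2 - 1) * Q τ i i := by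
    have : ∀ j, e j * Q τ j j * e j
        = Q τ j j + if j = i then (Real.exp t ^ 2 - 1) * Q τ i i else 0 := fun j => by
      rcases eq_or_ne j i with rfl | hj
      · simp [e]; ring
      · simp [e, hj]
    simp only [trace, diag_apply, diagonal_mul, mul_diagonal, this, Finset.sum_add_distrib]
    simp
  have h2 := hτ (τ + Pi.single i t)
  have h3 : ∑ j, s j ^ 2 * (τ + Pi.single i t : ι → ℝ) j = ∑ j, s j ^ 2 * τ j + s i ^ 2 * t := by
    simp [mul_add, Finset.sum_add_distrib, Pi.single_apply]
  simp only [f, h3] at h2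
  linarith

theorem Matrix.exists_forall_sq_le_of_isUnit {A : Matrix ι ι ℝ} (hA : IsUnit A) {s : ι → ℝ}
    (hs : ∀ i, 0 < s i) (hAs : ∀ i, s i ≤ A i i) (hsum : ∑ i, s i ^ 2 ≤ 1) :
    ∃ v : ι → ℝ, ∑ i, v i ^ 2 ≤ 1 ∧ ∀ i, s i ^ 2 ≤ |(A *ᵥ v) i| := by
  obtain ⟨d, P, V, hd, hP, hV, hPV, hdiag⟩ := exists_scaling_polar_diag hA hs hAs
  obtain ⟨x, hx, hPx⟩ := IsSymm.exists_signs_diag_mul_le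
    (P := P) (by simpa using hP.isHermitian) hd
  refine ⟨Vᵀ *ᵥ x, ?_, fun i => ?_⟩
  · have h1 : ∑ i, (Vᵀ *ᵥ x) i ^ 2 = ∑ i, d i ^ 2 := by
      have : (Vᵀ *ᵥ x) ⬝ᵥ (Vᵀ *ᵥ x) = x ⬝ᵥ x := by
        rw [dotProduct_mulVec, vecMul_mulVec, transpose_transpose]
        rw [hV, vecMul_one]
      simp only [dotProduct, ← pow_two] at this
      rw [this]
      exact Finset.sum_congr rfl fun i _ => by rw [← hx i, sq_abs]
    -- With this `E` the inequality reads `2 ∑ d i ^ 2 ≤ ∑ d i ^ 2 + ∑ s i ^ 2`.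
    have h := hP.two_mul_trace_mul_mul_le (diagonal fun i => d i / s i) hV
    rw [Matrix.mul_assoc, ← hPV, diagonal_transpose] at h
    have h2 : ∑ i, d i ^ 2 ≤ (diagonal (fun i => d i / s i) * (diagonal d * A)).trace := by
      refine Finset.sum_le_sum fun i _ => ?_
      simp only [diag_apply, diagonal_mul]
      have := hs i
      have := hd i
      calc d i ^ 2 = d i / s i * (d i * s i) := by field_simp
        _ ≤ _ := by gcongr; exact hAs i
    have h3 : (diagonal (fun i => d i / s i) * P * diagonal (fun i => d i / s i)).trace
        = ∑ i, d i ^ 2 := by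
      refine Finset.sum_congr rfl fun i _ => ?_
      simp only [diag_apply, diagonal_mul, mul_diagonal, hdiag]
      have := (hs i).ne'
      field_simp
    have h4 : P.trace = ∑ i, s i ^ 2 := Finset.sum_congr rfl fun i _ => hdiag i
    rw [h1]
    linarith
  · have h := hPx i
    have h1 : (P *ᵥ x) i = d i * (A *ᵥ (Vᵀ *ᵥ x)) i := by
      have : P *ᵥ x = (diagonal d * A) *ᵥ (Vᵀ *ᵥ x) := by
        rw [hPV, mulVec_mulVec, Matrix.mul_assoc, hV, Matrix.mul_one]
      rw [this, ← mulVec_mulVec, mulVec_diagonal]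
    rw [h1, abs_mul, abs_of_pos (hd i), hdiag, mul_comm] at h
    exact le_of_mul_le_mul_left h (hd i)

theorem Matrix.exists_small_isUnit_add_diagonal (H : Matrix ι ι ℝ) {r : ℝ} (hr : 0 < r) :
    ∃ δ, 0 < δ ∧ δ < r ∧ IsUnit (diagonal (fun _ => δ) + H) := by
  have hfin : {δ : ℝ | (-H).charpoly.IsRoot δ}.Finite :=
    Polynomial.finite_setOfPred_isRoot (charpoly_monic _).ne_zero
  obtain ⟨δ, hδ, hroot⟩ := ((Set.Ioo_infinite hr).sdiff hfin).nonempty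
  refine ⟨δ, hδ.1, hδ.2, ?_⟩
  rw [isUnit_iff_isUnit_det, isUnit_iff_ne_zero]
  intro h
  apply hroot
  rw [Set.mem_ofPred_eq, Polynomial.IsRoot, eval_charpoly, sub_neg_eq_add]
  exact h

/-- **Ball's plank theorem** in matrix form, homogeneous case with a factor of two lost. -/
theorem Matrix.exists_forall_half_sq_le {H : Matrix ι ι ℝ} (hH : ∀ i, H i i = 1) {s : ι → ℝ}
    (hs : ∀ i, 0 < s i) (hsum : ∑ i, s i ^ 2 ≤ 1) :
    ∃ v : ι → ℝ, ∑ i, v i ^ 2 ≤ 1 ∧ ∀ i, s i ^ 2 / 2 ≤ |∑ j, H i j * s j * v j| := by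
  obtain ⟨r, hr, hrs⟩ : ∃ r, 0 < r ∧ ∀ i, r ≤ s i / 2 := by
    rcases isEmpty_or_nonempty ι with _ | _
    · exact ⟨1, one_pos, isEmptyElim⟩
    · obtain ⟨i, hi⟩ := Finite.exists_min s
      exact ⟨s i / 2, half_pos (hs i), fun j => by linarith [hi j]⟩
  -- Perturbing to an invertible matrix costs at most `s i ^ 2 / 2` in coordinate `i`: hence the
  -- factor of two.
  obtain ⟨δ, hδ, hδr, hunit⟩ := exists_small_isUnit_add_diagonal H hr
  have hsu : IsUnit (diagonal s) := by
    rw [isUnit_diagonal, Pi.isUnit_iff]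
    exact fun i => (hs i).ne'.isUnit
  obtain ⟨v, hv, hAv⟩ := exists_forall_sq_le_of_isUnit (hunit.mul hsu) hs (fun i => by
    simp only [mul_diagonal, add_apply, diagonal_apply_eq, hH]
    nlinarith [hs i]) hsum
  refine ⟨v, hv, fun i => ?_⟩
  have h := hAv i
  have h1 : (((diagonal fun _ => δ) + H) * diagonal s) *ᵥ v
      = fun i => δ * (s i * v i) + ∑ j, H i j * s j * v j := by
    rw [Matrix.add_mul, add_mulVec, diagonal_mul_diagonal]
    ext i
    rw [Pi.add_apply, mulVec_diagonal, mul_assoc]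
    simp only [mulVec, dotProduct, mul_diagonal]
  have hvi : |v i| ≤ 1 := by
    rw [← sq_le_one_iff_abs_le_one]
    exact (Finset.single_le_sum (f := fun i => v i ^ 2)
      (fun i _ => sq_nonneg _) (Finset.mem_univ i)).trans hv
  have h2 : |δ * (s i * v i)| ≤ s i ^ 2 / 2 := by
    rw [abs_mul, abs_mul, abs_of_pos hδ, abs_of_pos (hs i)]
    have := hs i
    calc δ * (s i * |v i|) ≤ (s i / 2) * (s i * 1) := by
          gcongr
          exact hδr.le.trans (hrs i)
      _ = _ := by ring
  rw [h1] at h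
  linarith [abs_add_le (δ * (s i * v i)) (∑ j, H i j * s j * v j)]

end Plank

/-! ### From matrices to functionals on a Banach space -/

section BanachSpace

variable {X : Type*} [NormedAddCommGroup X] [NormedSpace ℝ X]

/-- The norm need not be attained on the unit ball; radius two leaves room to rescale a
near-maximiser. -/
theorem StrongDual.exists_norm_le_two_apply_eq_norm (f : StrongDual ℝ X) :
    ∃ x : X, ‖x‖ ≤ 2 ∧ f x = ‖f‖ := by
  rcases eq_or_ne f 0 with rfl | hf
  · exact ⟨0, by simp⟩
  have hpos : 0 < ‖f‖ := norm_pos_iff.2 hf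
  obtain ⟨x, hx, hfx⟩ := f.exists_lt_apply_of_lt_opNorm (half_lt_self hpos)
  have hfx0 : f x ≠ 0 := fun h => by simp [h] at hfx; linarith
  refine ⟨(‖f‖ / f x) • x, ?_, by simp [hfx0]⟩
  have hfp : 0 < ‖f x‖ := norm_pos_iff.2 hfx0
  rw [norm_smul, norm_div, norm_norm]
  calc ‖f‖ / ‖f x‖ * ‖x‖ ≤ 2 * 1 := by
        gcongr
        rw [div_le_iff₀ hfp]; linarith
    _ = 2 := mul_one 2

theorem exists_lp_two_synthesis [CompleteSpace X] {y : ℕ → X}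
    (hy : Summable fun n => ‖y n‖ ^ 2) :
    ∃ T : lp (fun _ : ℕ => ℝ) 2 →L[ℝ] X, ∀ n, T (lp.single 2 n (1 : ℝ)) = y n := by
  have hsum (f : lp (fun _ : ℕ => ℝ) 2) : Summable fun n => f n • y n := by
    have hf : Summable fun n => ‖f n‖ ^ 2 := by
      simpa using (lp.memℓp f).summable (by norm_num)
    refine Summable.of_norm_bounded ((hf.add hy).div_const 2) fun n => ?_
    rw [norm_smul]
    linarith [two_mul_le_add_sq ‖f n‖ ‖y n‖]
  let g : ℕ → lp (fun _ : ℕ => ℝ) 2 →L[ℝ] X := fun N =>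
    ∑ n ∈ Finset.range N, (innerSL ℝ (lp.single 2 n (1 : ℝ))).smulRight (y n)
  have hg : Tendsto (fun N f => g N f) atTop
      (𝓝 fun f : lp (fun _ : ℕ => ℝ) 2 => ∑' n, f n • y n) := by
    refine tendsto_pi_nhds.2 fun f => ?_
    simpa [g, sum_apply, lp.inner_single_left]
      using (hsum f).hasSum.tendsto_sum_nat
  refine ⟨continuousLinearMapOfTendsto g hg, fun n => ?_⟩
  change ∑' m, (lp.single 2 n (1 : ℝ) : lp (fun _ : ℕ => ℝ) 2) m • y m = y n
  rw [tsum_eq_single n]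
  · simp
  · intro m hm
    simp [hm]

theorem norm_sum_smul_single_sq {u : Finset ℕ} (v : u → ℝ) :
    ‖(∑ j : u, v j • lp.single 2 (j : ℕ) (1 : ℝ) : lp (fun _ : ℕ => ℝ) 2)‖ ^ 2
      = ∑ j, v j ^ 2 := by
  rw [← real_inner_self_eq_norm_sq]
  simp only [sum_inner, inner_sum, real_inner_smul_left, real_inner_smul_right,
    lp.inner_single_left]
  refine Finset.sum_congr rfl fun i _ => ?_
  rw [Finset.sum_eq_single i]
  · simp; ring
  · intro j _ hj
    have : (i : ℕ) ≠ j := fun h => hj (Subtype.ext h.symm)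
    simp [this]
  · simp

/-- If `∑ ‖φ n‖⁻¹ < ∞`, some vector is bounded away from all the kernels of the `φ n`
simultaneously: a homogeneous form of **Ball's plank theorem**. -/
theorem exists_forall_le_abs_apply [CompleteSpace X] {φ : ℕ → StrongDual ℝ X}
    (hφ : ∀ n, 0 < ‖φ n‖) (hsum : Summable fun n => ‖φ n‖⁻¹) :
    ∃ x : X, ∃ c > 0, ∀ n, c ≤ |φ n x| := by
  choose x hx hφx using fun n => (φ n).exists_norm_le_two_apply_eq_norm
  let S := ∑' n, ‖φ n‖⁻¹
  have hS : 0 < S := hsum.tsum_pos (fun n => inv_nonneg.2 (norm_nonneg _)) 0 (inv_pos.2 (hφ 0))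
  -- Chosen so that `‖φ n‖ * s n ^ 2 / 2` is the constant `(2 * S)⁻¹`.
  let s : ℕ → ℝ := fun n => √(‖φ n‖⁻¹ / S)
  have hs (n) : 0 < s n := Real.sqrt_pos.2 (div_pos (inv_pos.2 (hφ n)) hS)
  have hs2 (n) : s n ^ 2 = ‖φ n‖⁻¹ / S :=
    Real.sq_sqrt (div_pos (inv_pos.2 (hφ n)) hS).le
  have hs2sum : Summable fun n => s n ^ 2 := by simpa only [hs2] using hsum.div_const S
  have hs2tsum : ∑' n, s n ^ 2 = 1 := by
    simp only [hs2, tsum_div_const]; exact div_self hS.ne'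
  obtain ⟨T, hT⟩ := exists_lp_two_synthesis (y := fun n => s n • x n) (by
    refine Summable.of_nonneg_of_le (fun n => sq_nonneg _) (fun n => ?_) (hs2sum.mul_left 4)
    rw [norm_smul, mul_pow, Real.norm_eq_abs, sq_abs]
    nlinarith [sq_nonneg (s n), pow_le_pow_left₀ (norm_nonneg _) (hx n) 2])
  let E := lp (fun _ : ℕ => ℝ) 2
  let D := InnerProductSpace.toDual ℝ E
  let g : ℕ → E := fun n => D.symm ((φ n).comp T)
  have hg (n) (f : E) : inner ℝ (g n) f = φ n (T f) :=
    InnerProductSpace.toDual_symm_apply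
  -- The matrix theorem handles finitely many constraints; these are weak* closed, so compactness of
  -- the ball yields all at once.
  obtain ⟨ψ, -, hψ⟩ := (WeakDual.isCompact_closedBall (𝕜 := ℝ) (0 : StrongDual ℝ E) 1
    ).inter_iInter_nonempty (fun n => {ψ : WeakDual ℝ E | (2 * S)⁻¹ ≤ |ψ (g n)|})
    (fun n => isClosed_le continuous_const (WeakDual.eval_continuous (g n)).abs) (by
      intro u
      obtain ⟨v, hv, hHv⟩ := Matrix.exists_forall_half_sq_le (ι := u)
        (H := Matrix.of fun i j => φ i (x j) / ‖φ i‖) (s := fun i => s i)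
        (fun i => by simp [hφx, (hφ i).ne']) (fun i => hs i) (by
          rw [Finset.sum_coe_sort u fun i => s i ^ 2, ← hs2tsum]
          exact hs2sum.sum_le_tsum _ fun _ _ => sq_nonneg _)
      let f : E := ∑ j : u, v j • lp.single 2 (j : ℕ) (1 : ℝ)
      have hf : ‖f‖ ≤ 1 := by
        rw [← sq_le_one_iff₀ (norm_nonneg f), norm_sum_smul_single_sq]
        exact hv
      have hTf : T f = ∑ j : u, v j • s j • x j := by simp [f, hT]
      refine ⟨StrongDual.toWeakDual (D f), ?_, ?_⟩
      · simpa [D] using hf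
      · simp only [Set.mem_iInter]
        intro n hn
        change (2 * S)⁻¹ ≤ |D f (g n)|
        rw [InnerProductSpace.toDual_apply_apply, real_inner_comm, hg, hTf, map_sum]
        have h := hHv ⟨n, hn⟩
        have hrw : ∑ j : u, (Matrix.of fun i j : u => φ i (x j) / ‖φ i‖) ⟨n, hn⟩ j * s j * v j
            = (∑ j : u, φ n (v j • s j • x j)) / ‖φ n‖ := by
          rw [Finset.sum_div]
          refine Finset.sum_congr rfl fun j _ => ?_
          simp only [Matrix.of_apply, map_smul, smul_eq_mul]
          ring
        rw [hrw, abs_div, abs_norm, le_div_iff₀ (hφ n)] at h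
        refine le_of_eq_of_le ?_ h
        simp only [hs2]
        have := (hφ n).ne'
        field_simp)
  refine ⟨T (D.symm (WeakDual.toStrongDual ψ)), (2 * S)⁻¹, by positivity, fun n => ?_⟩
  have h := Set.mem_iInter.1 hψ n
  rw [← hg, real_inner_comm, InnerProductSpace.toDual_symm_apply]
  exact h

end BanachSpace

theorem mainTheorem7 {X : Type*} [NormedAddCommGroup X] [NormedSpace ℝ X] [CompleteSpace X]
    (a : ℕ → ℝ) (ha : ∀ n, 0 < a n) (hacc : IsWeakStarAcceptable X a) :
    Tendsto (fun N : ℕ => ∑ n ∈ Finset.range N, (a n)⁻¹) atTop atTop := by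
  obtain ⟨φ, hφ, hclus⟩ := hacc
  by_contra hnot
  have hsum : Summable fun n => ‖φ n‖⁻¹ := by
    simp only [hφ]
    by_contra h
    exact hnot ((not_summable_iff_tendsto_nat_atTop_of_nonneg
      fun n => (inv_pos.2 (ha n)).le).1 h)
  obtain ⟨x, c, hc, hx⟩ := exists_forall_le_abs_apply (fun n => (hφ n).symm ▸ ha n) hsum
  have hopen : {ψ : WeakDual ℝ X | |ψ x| < c} ∈ 𝓝 (0 : WeakDual ℝ X) :=
    (isOpen_lt (WeakDual.eval_continuous x).abs continuous_const).mem_nhds (by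
      have : (0 : WeakDual ℝ X) x = 0 := rfl
      simpa [this] using hc)
  obtain ⟨n, hn⟩ := (hclus.frequently hopen).exists
  exact absurd (hx n) (not_le.2 hn)
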